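/- Let $k$ be a field, let $\Lambda$ be a finite-dimensional symmetric $k$-algebra (that is, there is a $k$-linear form $\varphi:\Lambda\to k$ with $\varphi(ab)=\varphi(ba)$ for all $a,b$ such that the bilinear form $(a,b)\mapsto\varphi(ab)$ is non-degenerate), and let $C$ be an indecomposable perfect complex over $\Lambda$, i.e. an indecomposable object of the derived category of $\Lambda$-modules that is isomorphic there to a finite complex of finitely generated projective $\Lambda$-modules. Write $\operatorname{End}(C)=\operatorname{End}_{D^b(\Lambda)}(C)$ for its endomorphism algebra in the derived category. (1) If $k$ is algebraically closed, then $\dim_k \operatorname{End}(C)=1$ if and only if $C$ is isomorphic, in the derived category, to a simple projective $\Lambda$-module concentrated in a single degree. (2) For an arbitrary field $k$: if $\dim_k\operatorname{End}(C)=1$, then $C$ is isomorphic to a simple projective $\Lambda$-module concentrated in a single degree; and if $C$ is not isomorphic to such a complex, then $\dim_k \operatorname{End}(C)$ is finite and at least $2$. -/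

import Mathlib

open CategoryTheory

universe w u v

/-- A finite-dimensional `k`-algebra `Λ` is *symmetric* if it has a symmetrizing form: a linear form
`φ : Λ → k` with `φ (a * b) = φ (b * a)` for which the bilinear form `(a, b) ↦ φ (a * b)` is
non-degenerate. (In finite dimension this says that `Λ` is isomorphic to `Hom_k(Λ, k)` as a
bimodule, the isomorphism being `a ↦ φ (a * ·)`.) -/
def IsSymmetricFinDimAlgebra (k : Type v) (Λ : Type u) [Field k] [Ring Λ] [Algebra k Λ]
    [Module.Finite k Λ] : Prop :=
  ∃ φ : Λ →ₗ[k] k, (∀ a b : Λ, φ (a * b) = φ (b * a)) ∧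
    ∀ a : Λ, (∀ b : Λ, φ (a * b) = 0) → a = 0

section

variable {Λ : Type u} [Ring Λ]

/-- A cochain complex of `Λ`-modules that is a finite complex of finitely generated projective
modules. -/
structure IsStrictlyPerfect (K : CochainComplex (ModuleCat.{u} Λ) ℤ) : Prop where
  /-- only finitely many terms are nonzero -/
  bounded : ∃ a b : ℤ, ∀ i : ℤ, i < a ∨ b < i → Limits.IsZero (K.X i)
  finite (i : ℤ) : Module.Finite Λ (K.X i)
  projective (i : ℤ) : Module.Projective Λ (K.X i)

variable [HasDerivedCategory.{w} (ModuleCat.{u} Λ)]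

/-- An object of the derived category of `Λ`-modules is *perfect* if it is isomorphic there to a
finite complex of finitely generated projective modules. -/
def IsPerfectComplex (C : DerivedCategory (ModuleCat.{u} Λ)) : Prop :=
  ∃ K : CochainComplex (ModuleCat.{u} Λ) ℤ,
    IsStrictlyPerfect K ∧ Nonempty (C ≅ DerivedCategory.Q.obj K)

/-- An object of the derived category that is (isomorphic to) a simple projective module
concentrated in a single degree. -/
def IsSimpleProjectiveInOneDegree (C : DerivedCategory (ModuleCat.{u} Λ)) : Prop :=
  ∃ (S : ModuleCat.{u} Λ) (n : ℤ), IsSimpleModule Λ S ∧ Module.Projective Λ S ∧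
    Nonempty (C ≅ (DerivedCategory.singleFunctor (ModuleCat.{u} Λ) n).obj S)

end

/-! The engine is a trace on finitely generated projectives: the Hattori–Stallings trace composed
with the symmetrizing form `φ`. Represent `C` by a strictly perfect complex `K`. As `C` is nonzero,
`K` has a cycle `x` in some degree `n` that is not a boundary, and `φ` yields `g : K.X n → Λ`
killing boundaries with `φ (g x) ≠ 0`. The composite `K → Λ → K` through degree `n`, `y ↦ g y • x`,
has trace `φ (g x)`, whereas null-homotopic maps living in one degree have trace zero; so it is
nonzero in the derived category.

If `End C` is one-dimensional, this composite is invertible, so `C` is a retract of a shift of `Λ`,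
that is, a projective module `P` in one degree. Applied to `P`, the same rank-one maps show that `P`
is simple. The converse is Schur's lemma. -/

/-! ### Functionals represented by the symmetrizing form -/

section SymmetrizingForm

variable {k : Type v} {Λ : Type u} [Field k] [Ring Λ] [Algebra k Λ]

/-- A non-degenerate form on a finite-dimensional algebra represents every functional on every
module by a module homomorphism to the algebra. -/
theorem exists_linearMap_comp_eq_dual [Module.Finite k Λ] {φ : Λ →ₗ[k] k}
    (hφ : ∀ a : Λ, (∀ b : Λ, φ (a * b) = 0) → a = 0) (hs : ∀ a b : Λ, φ (a * b) = φ (b * a))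
    {M : Type*} [AddCommGroup M] [Module Λ M] [Module k M] [IsScalarTower k Λ M]
    (f : M →ₗ[k] k) : ∃ g : M →ₗ[Λ] Λ, ∀ m, φ (g m) = f m := by
  let B : Λ →ₗ[k] Module.Dual k Λ := (LinearMap.mul k Λ).compr₂ φ
  have hB : ∀ a b, B a b = φ (a * b) := fun _ _ => rfl
  have hinj : Function.Injective B := by
    rw [← LinearMap.ker_eq_bot, LinearMap.ker_eq_bot']
    intro a ha
    exact hφ a fun b => by rw [← hB, ha, LinearMap.zero_apply]
  have hsurj : Function.Surjective B :=
    (LinearMap.injective_iff_surjective_of_finrank_eq_finrank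
      (Subspace.dual_finrank_eq (K := k) (V := Λ)).symm).1 hinj
  -- `g m` is the element representing the functional `a ↦ f (a • m)`.
  choose g hg using fun m : M =>
    hsurj (f.comp ((LinearMap.toSpanSingleton Λ M m).restrictScalars k))
  have hg' : ∀ m a, φ (g m * a) = f (a • m) := fun m a => by
    rw [← hB, hg]; rfl
  have key : ∀ {x y : Λ}, (∀ b, φ (x * b) = φ (y * b)) → x = y := fun {x y} h =>
    hinj (LinearMap.ext fun b => by rw [hB, hB, h])
  refine ⟨{ toFun := g, map_add' := fun x y => key fun b => ?_,
            map_smul' := fun a x => key fun b => ?_ }, fun m => ?_⟩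
  · rw [hg', add_mul, map_add, hg', hg', smul_add, map_add]
  · rw [hg', RingHom.id_apply, smul_eq_mul, mul_assoc, hs, mul_assoc, hg', mul_smul]
  · have := hg' m 1
    rwa [mul_one, one_smul] at this

/-- A symmetric algebra cogenerates its modules: homomorphisms to the algebra detect nonzero
elements, even after applying the symmetrizing form. -/
theorem exists_linearMap_form_ne_zero [Module.Finite k Λ] {φ : Λ →ₗ[k] k}
    (hφ : ∀ a : Λ, (∀ b : Λ, φ (a * b) = 0) → a = 0) (hs : ∀ a b : Λ, φ (a * b) = φ (b * a))
    {M : Type*} [AddCommGroup M] [Module Λ M] (N : Submodule Λ M) {x : M} (hx : x ∉ N) :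
    ∃ g : M →ₗ[Λ] Λ, (∀ y ∈ N, g y = 0) ∧ φ (g x) ≠ 0 := by
  let : Module k (M ⧸ N) := Module.restrictScalars k Λ (M ⧸ N)
  have : IsScalarTower k Λ (M ⧸ N) := IsScalarTower.restrictScalars k Λ (M ⧸ N)
  have hx' : N.mkQ x ≠ 0 := by simpa using hx
  obtain ⟨f, hf⟩ : ∃ f : Module.Dual k (M ⧸ N), f (N.mkQ x) ≠ 0 := by
    by_contra! h
    exact hx' ((Module.forall_dual_apply_eq_zero_iff k _).1 h)
  obtain ⟨g, hg⟩ := exists_linearMap_comp_eq_dual hφ hs f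
  refine ⟨g.comp N.mkQ, fun y hy => ?_, ?_⟩
  · rw [LinearMap.comp_apply, Submodule.mkQ_apply, (Submodule.Quotient.mk_eq_zero N).2 hy, map_zero]
  · rwa [LinearMap.comp_apply, hg]

end SymmetrizingForm

/-! ### Traces on finitely generated projective modules -/

section DualBasis

theorem Module.Projective.exists_finite_dual_basis (Λ : Type*) [Ring Λ] (P : Type*)
    [AddCommGroup P] [Module Λ P] [Module.Finite Λ P] [Module.Projective Λ P] :
    ∃ (n : ℕ) (x : Fin n → P) (ξ : Fin n → P →ₗ[Λ] Λ), ∀ p, ∑ i, ξ i p • x i = p := by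
  obtain ⟨n, f, g, -, -, h⟩ := Module.Finite.exists_comp_eq_id_of_projective Λ P
  refine ⟨n, fun i => f (Pi.single i 1), fun i => (LinearMap.proj i).comp g, fun p => ?_⟩
  conv_rhs => rw [← LinearMap.id_apply (R := Λ) p, ← h, LinearMap.comp_apply,
    pi_eq_sum_univ' (g p), map_sum]
  refine Finset.sum_congr rfl fun i _ => ?_
  rw [map_smul]
  rfl

variable {k : Type v} {Λ : Type u} [Field k] [Ring Λ] [Algebra k Λ]

/-- The trace of an endomorphism of a finitely generated projective module, with values in `k`
through a linear form on the algebra. -/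
noncomputable def formTrace (φ : Λ →ₗ[k] k) (P : Type*) [AddCommGroup P] [Module Λ P]
    [Module.Finite Λ P] [Module.Projective Λ P] : (P →ₗ[Λ] P) →+ k :=
  let x := (Module.Projective.exists_finite_dual_basis Λ P).choose_spec.choose
  let ξ := (Module.Projective.exists_finite_dual_basis Λ P).choose_spec.choose_spec.choose
  { toFun := fun h => ∑ i, φ (ξ i (h (x i)))
    map_zero' := by simp
    map_add' := fun a b => by simp [Finset.sum_add_distrib] }

theorem exists_formTrace_eq_sum (φ : Λ →ₗ[k] k) (P : Type*) [AddCommGroup P] [Module Λ P]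
    [Module.Finite Λ P] [Module.Projective Λ P] :
    ∃ (n : ℕ) (x : Fin n → P) (ξ : Fin n → P →ₗ[Λ] Λ), (∀ p, ∑ i, ξ i p • x i = p) ∧
      ∀ h, formTrace φ P h = ∑ i, φ (ξ i (h (x i))) :=
  ⟨_, _, _, (Module.Projective.exists_finite_dual_basis Λ P).choose_spec.choose_spec.choose_spec,
    fun _ => rfl⟩

/-- Expanding in dual bases of both modules gives the same double sum up to swapping the factors
inside `φ`. Applied to two dual bases of one module, this also gives independence of the choice. -/
theorem formTrace_comp_comm {φ : Λ →ₗ[k] k} (hs : ∀ a b : Λ, φ (a * b) = φ (b * a))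
    {P Q : Type*} [AddCommGroup P] [Module Λ P]
    [Module.Finite Λ P] [Module.Projective Λ P] [AddCommGroup Q] [Module Λ Q]
    [Module.Finite Λ Q] [Module.Projective Λ Q] (a : P →ₗ[Λ] Q) (b : Q →ₗ[Λ] P) :
    formTrace φ P (b ∘ₗ a) = formTrace φ Q (a ∘ₗ b) := by
  obtain ⟨m, x, ξ, hx, hP⟩ := exists_formTrace_eq_sum φ P
  obtain ⟨n, y, η, hy, hQ⟩ := exists_formTrace_eq_sum φ Q
  have h₁ : ∀ i, φ (ξ i (b (a (x i)))) = ∑ j, φ (η j (a (x i)) * ξ i (b (y j))) := fun i => by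
    conv_lhs => rw [← hy (a (x i))]
    simp only [map_sum, map_smul, smul_eq_mul]
  have h₂ : ∀ j, φ (η j (a (b (y j)))) = ∑ i, φ (ξ i (b (y j)) * η j (a (x i))) := fun j => by
    conv_lhs => rw [← hx (b (y j))]
    simp only [map_sum, map_smul, smul_eq_mul]
  simp only [hP, hQ, LinearMap.comp_apply, h₁, h₂]
  rw [Finset.sum_comm]
  exact Finset.sum_congr rfl fun j _ => Finset.sum_congr rfl fun i _ => hs _ _

theorem formTrace_toSpanSingleton_comp {φ : Λ →ₗ[k] k} (hs : ∀ a b : Λ, φ (a * b) = φ (b * a))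
    {P : Type*} [AddCommGroup P] [Module Λ P]
    [Module.Finite Λ P] [Module.Projective Λ P] (p : P) (g : P →ₗ[Λ] Λ) :
    formTrace φ P (LinearMap.toSpanSingleton Λ P p ∘ₗ g) = φ (g p) := by
  obtain ⟨m, x, ξ, hx, hP⟩ := exists_formTrace_eq_sum φ P
  conv_rhs => rw [← hx p]
  simp only [hP, LinearMap.comp_apply, LinearMap.toSpanSingleton_apply, map_sum, map_smul,
    smul_eq_mul]
  exact Finset.sum_congr rfl fun i _ => hs _ _

/-- Over a symmetric algebra, a nonzero finitely generated projective module all of whose nonzero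
endomorphisms are bijective is simple. -/
theorem isSimpleModule_of_bijective_of_ne_zero [Module.Finite k Λ]
    (hΛ : IsSymmetricFinDimAlgebra k Λ) {P : Type*} [AddCommGroup P] [Module Λ P] [Nontrivial P]
    [Module.Finite Λ P] [Module.Projective Λ P]
    (h : ∀ f : P →ₗ[Λ] P, f ≠ 0 → Function.Bijective f) : IsSimpleModule Λ P := by
  obtain ⟨φ, hs, hφ⟩ := hΛ
  rw [isSimpleModule_iff]
  refine { eq_bot_or_eq_top := fun N => or_iff_not_imp_left.2 fun hN => ?_ }
  obtain ⟨x, hxN, hx⟩ := N.ne_bot_iff.1 hN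
  obtain ⟨g, -, hg⟩ := exists_linearMap_form_ne_zero hφ hs (⊥ : Submodule Λ P)
    (show x ∉ (⊥ : Submodule Λ P) by simpa using hx)
  have hne : LinearMap.toSpanSingleton Λ P x ∘ₗ g ≠ 0 := fun h0 => hg <| by
    rw [← formTrace_toSpanSingleton_comp hs, h0, map_zero]
  -- The surjective map `z ↦ g z • x` has its image in `N`.
  refine N.eq_top_iff'.2 fun y => ?_
  obtain ⟨z, rfl⟩ := (h _ hne).2 y
  exact N.smul_mem _ hxN

end DualBasis

/-! ### Morphisms between perfect complexes -/

section Complexes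

variable {Λ : Type u} [Ring Λ]

theorem IsStrictlyPerfect.isKProjective {K : CochainComplex (ModuleCat.{u} Λ) ℤ}
    (hK : IsStrictlyPerfect K) : K.IsKProjective := by
  obtain ⟨a, b, hab⟩ := hK.bounded
  have : K.IsStrictlyLE b :=
    (K.isStrictlyLE_iff b).2 fun i hi => hab i (Or.inr hi)
  have (n : ℤ) : Projective (K.X n) :=
    have := hK.projective n
    ModuleCat.projective_of_categoryTheory_projective _
  exact CochainComplex.isKProjective_of_projective K b

theorem CochainComplex.IsKProjective.Q_map_surjective {C : Type*} [Category* C] [Abelian C]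
    [HasDerivedCategory.{w} C] (K L : CochainComplex C ℤ) [K.IsKProjective] :
    Function.Surjective (DerivedCategory.Q.map : (K ⟶ L) → _) := fun f => by
  obtain ⟨g, hg⟩ := (CochainComplex.IsKProjective.Qh_map_bijective K
    ((HomotopyCategory.quotient _ _).obj L)).2
    ((DerivedCategory.quotientCompQhIso C).hom.app K ≫ f ≫
      (DerivedCategory.quotientCompQhIso C).inv.app L)
  obtain ⟨g, rfl⟩ := (HomotopyCategory.quotient _ _).map_surjective g
  refine ⟨g, ?_⟩
  rw [← cancel_epi ((DerivedCategory.quotientCompQhIso C).hom.app K),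
    ← DerivedCategory.quotientCompQhIso_hom_naturality, hg]
  simp

theorem CochainComplex.IsKProjective.homotopy_of_Q_map_eq_zero {C : Type*} [Category* C]
    [Abelian C] [HasDerivedCategory.{w} C] {K L : CochainComplex C ℤ} [K.IsKProjective]
    (f : K ⟶ L) (hf : DerivedCategory.Q.map f = 0) : Nonempty (Homotopy f 0) := by
  refine ⟨HomotopyCategory.homotopyOfEq _ _
    ((CochainComplex.IsKProjective.Qh_map_bijective K _).1 ?_)⟩
  rw [← cancel_mono ((DerivedCategory.quotientCompQhIso C).hom.app L),
    DerivedCategory.quotientCompQhIso_hom_naturality, hf]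
  simp

theorem exists_not_exactAt_of_not_isZero {C : Type*} [Category* C] [Abelian C]
    [HasDerivedCategory.{w} C] {K : CochainComplex C ℤ} [K.IsKProjective]
    (hK : ¬ Limits.IsZero (DerivedCategory.Q.obj K)) : ∃ n, ¬ K.ExactAt n := by
  by_contra! h
  refine hK ((Limits.IsZero.iff_id_eq_zero _).2 ?_)
  rw [← CategoryTheory.Functor.map_id, DerivedCategory.Q_map_eq_of_homotopy _
    (CochainComplex.IsKProjective.homotopyZero (𝟙 K) h), Functor.map_zero]

variable {k : Type v} [Field k] [Algebra k Λ] [Module.Finite k Λ]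

theorem ModuleCat.finite_hom (M N : ModuleCat.{u} Λ) [Module.Finite Λ M] [Module.Finite Λ N] :
    Module.Finite k (M ⟶ N) := by
  have : IsScalarTower k Λ M := ModuleCat.isScalarTower_of_algebra_moduleCat M
  have : IsScalarTower k Λ N := ModuleCat.isScalarTower_of_algebra_moduleCat N
  have : Module.Finite k M := Module.Finite.trans Λ M
  have : Module.Finite k N := Module.Finite.trans Λ N
  let F : (M ⟶ N) →ₗ[k] (M →ₗ[k] N) :=
    { toFun := fun f => f.hom.restrictScalars k
      map_add' := fun _ _ => rfl
      map_smul' := fun _ _ => rfl }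
  refine Module.Finite.of_injective F fun f g h => ?_
  ext x
  exact LinearMap.congr_fun h x

theorem IsStrictlyPerfect.finite_hom {K L : CochainComplex (ModuleCat.{u} Λ) ℤ}
    (hK : IsStrictlyPerfect K) (hL : IsStrictlyPerfect L) : Module.Finite k (K ⟶ L) := by
  obtain ⟨a, b, hab⟩ := hK.bounded
  have (i : Set.Icc a b) : Module.Finite k (K.X i ⟶ L.X i) :=
    have := hK.finite i
    have := hL.finite i
    ModuleCat.finite_hom _ _
  let F : (K ⟶ L) →ₗ[k] (∀ i : Set.Icc a b, K.X i ⟶ L.X i) :=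
    { toFun := fun f i => f.f i
      map_add' := fun _ _ => rfl
      map_smul' := fun _ _ => rfl }
  refine Module.Finite.of_injective F fun f g h => ?_
  ext1 i
  by_cases hi : i ∈ Set.Icc a b
  · exact congrFun h ⟨i, hi⟩
  · refine (hab i ?_).eq_of_src _ _
    by_contra! h'
    exact hi h'

theorem IsPerfectComplex.finite_hom [HasDerivedCategory.{w} (ModuleCat.{u} Λ)]
    {C D : DerivedCategory (ModuleCat.{u} Λ)}
    (hC : IsPerfectComplex C) (hD : IsPerfectComplex D) : Module.Finite k (C ⟶ D) := by
  obtain ⟨K, hK, ⟨e⟩⟩ := hC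
  obtain ⟨L, hL, ⟨e'⟩⟩ := hD
  have := hK.isKProjective
  have : Module.Finite k (K ⟶ L) := hK.finite_hom hL
  have : Module.Finite k (DerivedCategory.Q.obj K ⟶ DerivedCategory.Q.obj L) :=
    Module.Finite.of_surjective (DerivedCategory.Q.mapLinearMap k)
      (CochainComplex.IsKProjective.Q_map_surjective K L)
  exact Module.Finite.equiv (Linear.homCongr k e e').symm

end Complexes

/-! ### Traces and null-homotopic maps -/

section Trace

variable {k : Type v} {Λ : Type u} [Field k] [Ring Λ] [Algebra k Λ]

/-- A null-homotopic endomorphism concentrated in one degree of a strictly perfect complex has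
trace zero. -/
theorem IsStrictlyPerfect.formTrace_eq_zero_of_homotopy {φ : Λ →ₗ[k] k}
    (hs : ∀ a b : Λ, φ (a * b) = φ (b * a)) {K : CochainComplex (ModuleCat.{u} Λ) ℤ}
    (hK : IsStrictlyPerfect K) {h : K ⟶ K} (H : Homotopy h 0) {n : ℤ}
    (hn : ∀ i, i ≠ n → h.f i = 0) [Module.Finite Λ (K.X n)] [Module.Projective Λ (K.X n)] :
    formTrace φ (K.X n) (h.f n).hom = 0 := by
  have hfin := hK.finite
  have hproj := hK.projective
  obtain ⟨a, b, hab⟩ := hK.bounded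
  let t : ℤ → k := fun i => formTrace φ (K.X i) (K.d i (i + 1) ≫ H.hom (i + 1) i).hom
  -- The two summands of `dh + hd`; cyclicity moves the second one to degree `i`.
  have ht : ∀ i, formTrace φ (K.X (i + 1)) (h.f (i + 1)).hom = t (i + 1) + t i := fun i => by
    have h₁ := H.comm (i + 1)
    rw [dNext_eq _ (show (ComplexShape.up ℤ).Rel (i + 1) (i + 1 + 1) from rfl),
      prevD_eq _ (show (ComplexShape.up ℤ).Rel i (i + 1) from rfl), HomologicalComplex.zero_f,
      add_zero] at h₁
    rw [h₁, ModuleCat.hom_add, map_add]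
    congr 1
    exact formTrace_comp_comm hs _ _
  have hzero : ∀ i, Limits.IsZero (K.X i) → t i = 0 := fun i hi => by
    have : K.d i (i + 1) ≫ H.hom (i + 1) i = 0 := hi.eq_of_src _ _
    simp only [t, this, ModuleCat.hom_zero, map_zero]
  have hstep : ∀ i, i + 1 ≠ n → t (i + 1) = - t i := fun i hi => by
    have := ht i
    rw [hn _ hi, ModuleCat.hom_zero, map_zero] at this
    exact eq_neg_of_add_eq_zero_left this.symm
  -- Away from `n` the values `t i` only alternate in sign, so vanishing spreads from outside the
  -- support of `K`: upwards to `n - 1` here, downwards to `n` in `hhigh`.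
  have hlow : ∀ i, i < n → t i = 0 := by
    have : ∀ m : ℕ, a - 1 + m < n → t (a - 1 + m) = 0 := fun m => by
      induction m with
      | zero => exact fun _ => hzero _ (hab _ (Or.inl (by simp)))
      | succ m ih =>
        intro hm
        have e : a - 1 + ((m + 1 : ℕ) : ℤ) = a - 1 + m + 1 := by push_cast; ring
        rw [e] at hm ⊢
        rw [hstep _ hm.ne, ih (by lia), neg_zero]
    intro i hi
    by_cases hia : i < a
    · exact hzero _ (hab _ (Or.inl hia))
    · obtain ⟨m, hm⟩ := Int.eq_ofNat_of_zero_le (show 0 ≤ i - (a - 1) by lia)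
      obtain rfl : i = a - 1 + m := by lia
      exact this m hi
  have hhigh : ∀ i, n ≤ i → t i = 0 := by
    have : ∀ m : ℕ, n ≤ b + 1 - m → t (b + 1 - m) = 0 := fun m => by
      induction m with
      | zero => exact fun _ => hzero _ (hab _ (Or.inr (by simp)))
      | succ m ih =>
        intro hm
        have e : b + 1 - (m : ℤ) = b + 1 - ((m + 1 : ℕ) : ℤ) + 1 := by push_cast; ring
        have h₂ := hstep (b + 1 - ((m + 1 : ℕ) : ℤ)) (by lia)
        rw [← e, ih (by lia)] at h₂
        exact neg_eq_zero.1 h₂.symm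
    intro i hi
    by_cases hia : b < i
    · exact hzero _ (hab _ (Or.inr hia))
    · obtain ⟨m, hm⟩ := Int.eq_ofNat_of_zero_le (show 0 ≤ b + 1 - i by lia)
      obtain rfl : i = b + 1 - m := by lia
      exact this m hi
  obtain ⟨j, rfl⟩ : ∃ j, n = j + 1 := ⟨n - 1, by ring⟩
  have := ht j
  rw [hlow j (by lia), hhigh (j + 1) le_rfl, add_zero] at this
  exact this

/-- A non-exact strictly perfect complex over a symmetric algebra has an endomorphism that is
nonzero up to homotopy and factors through the algebra placed in one degree. -/
theorem IsStrictlyPerfect.exists_comp_single_not_homotopic_zero [Module.Finite k Λ]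
    (hΛ : IsSymmetricFinDimAlgebra k Λ) {K : CochainComplex (ModuleCat.{u} Λ) ℤ}
    (hK : IsStrictlyPerfect K) {n : ℤ} (hn : ¬ K.ExactAt n) :
    ∃ (g : K ⟶ (HomologicalComplex.single _ _ n).obj (ModuleCat.of Λ Λ))
      (f : (HomologicalComplex.single _ _ n).obj (ModuleCat.of Λ Λ) ⟶ K),
      IsEmpty (Homotopy (g ≫ f) 0) := by
  obtain ⟨φ, hs, hφ⟩ := hΛ
  have := hK.finite n
  have := hK.projective n
  rw [K.exactAt_iff' (n - 1) n (n + 1) (by simp) (by simp), ShortComplex.moduleCat_exact_iff] at hn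
  push Not at hn
  obtain ⟨x, hx, hx'⟩ : ∃ x : K.X n, K.d n (n + 1) x = 0 ∧ ∀ y, K.d (n - 1) n y ≠ x := hn
  obtain ⟨g, hg, hgx⟩ := exists_linearMap_form_ne_zero hφ hs
    (LinearMap.range (K.d (n - 1) n).hom) (x := x) (by rintro ⟨y, hy⟩; exact hx' y hy)
  let G : K ⟶ (HomologicalComplex.single _ _ n).obj (ModuleCat.of Λ Λ) :=
    HomologicalComplex.mkHomToSingle (ModuleCat.ofHom g) fun i hi => by
      obtain rfl : i = n - 1 := eq_sub_of_add_eq hi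
      ext y
      exact hg _ ⟨y, rfl⟩
  let F : (HomologicalComplex.single _ _ n).obj (ModuleCat.of Λ Λ) ⟶ K :=
    HomologicalComplex.mkHomFromSingle (ModuleCat.ofHom (LinearMap.toSpanSingleton Λ (K.X n) x))
      fun i hi => by
        obtain rfl : n + 1 = i := hi
        ext
        exact (congrArg _ (one_smul Λ x)).trans hx
  refine ⟨G, F, ⟨fun H => hgx ?_⟩⟩
  have h₁ := hK.formTrace_eq_zero_of_homotopy hs H fun i hi => by
      rw [HomologicalComplex.comp_f, (HomologicalComplex.isZero_single_obj_X
        (ComplexShape.up ℤ) n (ModuleCat.of Λ Λ) i hi).eq_of_tgt (G.f i) 0, Limits.zero_comp]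
  have h₂ : (G ≫ F).f n = ModuleCat.ofHom (LinearMap.toSpanSingleton Λ (K.X n) x ∘ₗ g) := by
    rw [HomologicalComplex.comp_f, HomologicalComplex.mkHomToSingle_f,
      HomologicalComplex.mkHomFromSingle_f, Category.assoc, Iso.inv_hom_id_assoc]
    rfl
  rw [h₂] at h₁
  rw [← formTrace_toSpanSingleton_comp hs]
  exact h₁

end Trace

/-- The idempotent cutting out `Y` lifts along `F` and splits in `A`; two splittings of one
idempotent are isomorphic. -/
theorem CategoryTheory.Functor.exists_iso_obj_of_retract {A B : Type*} [Category* A] [Category* B]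
    [IsIdempotentComplete A] (F : A ⥤ B) [F.Full] [F.Faithful] {X : A} {Y : B}
    (r : Retract Y (F.obj X)) : ∃ P : A, Nonempty (Retract P X) ∧ Nonempty (Y ≅ F.obj P) := by
  obtain ⟨e, he⟩ := F.map_surjective (r.r ≫ r.i)
  obtain ⟨P, i, p, hip, hpi⟩ := IsIdempotentComplete.idempotents_split X e
    (F.map_injective (by simp [he]))
  refine ⟨P, ⟨⟨i, p, hip⟩⟩, ⟨⟨r.i ≫ F.map p, F.map i ≫ r.r, ?_, ?_⟩⟩⟩
  · rw [Category.assoc, ← F.map_comp_assoc, hpi, he]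
    simp
  · have h : F.map i ≫ r.r ≫ r.i = F.map i := by
      rw [← he, ← F.map_comp, ← hpi, reassoc_of% hip]
    rw [Category.assoc, reassoc_of% h, ← F.map_comp, hip, F.map_id]

/-! ### From endomorphisms to simple projectives -/

section Main

variable {k : Type v} [Field k] {Λ : Type u} [Ring Λ] [Algebra k Λ]
    [Module.Finite k Λ] [HasDerivedCategory.{w} (ModuleCat.{u} Λ)]

theorem isIso_of_ne_zero_of_finrank_eq_one {C : Type*} [Category* C] [Preadditive C]
    [Linear k C] {X : C} (h : Module.finrank k (X ⟶ X) = 1) {f : X ⟶ X} (hf : f ≠ 0) :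
    IsIso f := by
  have hid : 𝟙 X ≠ 0 := fun h0 => hf (by rw [← Category.id_comp f, h0, Limits.zero_comp])
  obtain ⟨c, rfl⟩ := (finrank_eq_one_iff_of_nonzero' (𝟙 X) hid).1 h f
  have hc : c ≠ 0 := by
    rintro rfl
    exact hf (zero_smul _ _)
  exact ⟨c⁻¹ • 𝟙 X, by simp [smul_smul, hc], by simp [smul_smul, hc]⟩

theorem IsPerfectComplex.exists_comp_singleFunctor_ne_zero (hΛ : IsSymmetricFinDimAlgebra k Λ)
    {C : DerivedCategory (ModuleCat.{u} Λ)} (hC : IsPerfectComplex C) (h0 : ¬ Limits.IsZero C) :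
    ∃ (n : ℤ) (g : C ⟶ (DerivedCategory.singleFunctor _ n).obj (ModuleCat.of Λ Λ))
      (f : (DerivedCategory.singleFunctor _ n).obj (ModuleCat.of Λ Λ) ⟶ C), g ≫ f ≠ 0 := by
  obtain ⟨K, hK, ⟨e⟩⟩ := hC
  have := hK.isKProjective
  obtain ⟨n, hn⟩ := exists_not_exactAt_of_not_isZero fun h => h0 (h.of_iso e)
  obtain ⟨g, f, hgf⟩ := hK.exists_comp_single_not_homotopic_zero hΛ hn
  refine ⟨n, e.hom ≫ DerivedCategory.Q.map g, DerivedCategory.Q.map f ≫ e.inv, fun h => ?_⟩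
  obtain ⟨H⟩ := CochainComplex.IsKProjective.homotopy_of_Q_map_eq_zero (g ≫ f) (by
    rw [Functor.map_comp, ← cancel_epi e.hom, ← cancel_mono e.inv, Limits.comp_zero,
      Limits.zero_comp, ← h, Category.assoc, Category.assoc]
    exact (Category.assoc _ _ _).symm)
  exact hgf.false H

theorem IsPerfectComplex.isSimpleProjectiveInOneDegree (hΛ : IsSymmetricFinDimAlgebra k Λ)
    {C : DerivedCategory (ModuleCat.{u} Λ)} (hC : IsPerfectComplex C) (h0 : ¬ Limits.IsZero C)
    (h : ∀ f : C ⟶ C, f ≠ 0 → IsIso f) : IsSimpleProjectiveInOneDegree C := by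
  obtain ⟨n, g, f, hgf⟩ := hC.exists_comp_singleFunctor_ne_zero hΛ h0
  have := h _ hgf
  obtain ⟨P, ⟨r⟩, ⟨e⟩⟩ :=
    (DerivedCategory.singleFunctor (ModuleCat.{u} Λ) n).exists_iso_obj_of_retract (X := ModuleCat.of Λ Λ) (Y := C)
    ⟨g, f ≫ inv (g ≫ f), by rw [← Category.assoc, IsIso.hom_inv_id]⟩
  have hr : r.r.hom ∘ₗ r.i.hom = LinearMap.id := by
    rw [← ModuleCat.hom_comp, r.retract, ModuleCat.hom_id]
  have : Module.Projective Λ P := Module.Projective.of_split r.i.hom r.r.hom hr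
  have : Module.Finite Λ P := Module.Finite.of_surjective r.r.hom fun y =>
    ⟨r.i.hom y, LinearMap.congr_fun hr y⟩
  have : Nontrivial P := by
    by_contra hP
    rw [not_nontrivial_iff_subsingleton] at hP
    exact h0 ((Functor.map_isZero _ (ModuleCat.isZero_of_subsingleton P)).of_iso e)
  refine ⟨P, n, isSimpleModule_of_bijective_of_ne_zero hΛ fun a ha => ?_, inferInstance, ⟨e⟩⟩
  let F := DerivedCategory.singleFunctor (ModuleCat.{u} Λ) n
  have hne : F.map (ModuleCat.ofHom a) ≠ 0 := fun h' => ha <| by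
    rw [← F.map_zero] at h'
    exact congrArg ModuleCat.Hom.hom (F.map_injective h')
  have h₁ : IsIso (e.hom ≫ F.map (ModuleCat.ofHom a) ≫ e.inv) := h _ fun h' => hne <| by
    rw [← cancel_epi e.hom, ← cancel_mono e.inv]
    simpa using h'
  have h₂ : IsIso (F.map (ModuleCat.ofHom a)) := by
    rw [show F.map (ModuleCat.ofHom a) =
      e.inv ≫ (e.hom ≫ F.map (ModuleCat.ofHom a) ≫ e.inv) ≫ e.hom by simp]
    infer_instance
  have : IsIso (ModuleCat.ofHom a) := isIso_of_reflects_iso _ F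
  exact ConcreteCategory.bijective_of_isIso (ModuleCat.ofHom a)

theorem IsSimpleProjectiveInOneDegree.isIso_iff_ne_zero
    {C : DerivedCategory (ModuleCat.{u} Λ)} (hC : IsSimpleProjectiveInOneDegree C)
    (h0 : ¬ Limits.IsZero C) (f : C ⟶ C) : IsIso f ↔ f ≠ 0 := by
  obtain ⟨S, n, hS, -, ⟨e⟩⟩ := hC
  let F := DerivedCategory.singleFunctor (ModuleCat.{u} Λ) n
  constructor
  · rintro hf rfl
    refine h0 ((Limits.IsZero.iff_id_eq_zero C).2 ?_)
    rw [← IsIso.hom_inv_id (0 : C ⟶ C), Limits.zero_comp]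
  · intro hf
    obtain ⟨a, ha⟩ := F.map_surjective (e.inv ≫ f ≫ e.hom)
    have hfa : f = e.hom ≫ F.map a ≫ e.inv := by rw [ha]; simp
    have hne : a.hom ≠ 0 := fun h' => hf <| by
      rw [hfa, show a = 0 from ModuleCat.hom_ext h']
      simp
    have : IsIso a := (ConcreteCategory.isIso_iff_bijective a).2
      ((LinearMap.bijective_or_eq_zero a.hom).resolve_right hne)
    rw [hfa]
    infer_instance

end Main

theorem proposition6p1 {k : Type v} [Field k] {Λ : Type u} [Ring Λ] [Algebra k Λ]
    [Module.Finite k Λ] [HasDerivedCategory.{w} (ModuleCat.{u} Λ)]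
    (hΛ : IsSymmetricFinDimAlgebra k Λ)
    (C : DerivedCategory (ModuleCat.{u} Λ))
    (hperf : IsPerfectComplex C) (hind : Indecomposable C) :
    (IsAlgClosed k → (Module.finrank k (C ⟶ C) = 1 ↔ IsSimpleProjectiveInOneDegree C)) ∧
    (Module.finrank k (C ⟶ C) = 1 → IsSimpleProjectiveInOneDegree C) ∧
    (¬ IsSimpleProjectiveInOneDegree C → 2 ≤ Module.finrank k (C ⟶ C)) := by
  have : Module.Finite k (C ⟶ C) := hperf.finite_hom hperf
  have hsimple : Module.finrank k (C ⟶ C) = 1 → IsSimpleProjectiveInOneDegree C := fun h =>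
    hperf.isSimpleProjectiveInOneDegree hΛ hind.1 fun _ hf =>
      isIso_of_ne_zero_of_finrank_eq_one (k := k) h hf
  refine ⟨fun _ => ⟨hsimple, fun h =>
    -- Schur's lemma; only here must `k` be algebraically closed.
    finrank_endomorphism_eq_one k (h.isIso_iff_ne_zero hind.1)⟩, hsimple, fun h => ?_⟩
  have : Nontrivial (C ⟶ C) :=
    ⟨𝟙 C, 0, fun h' => hind.1 ((Limits.IsZero.iff_id_eq_zero C).2 h')⟩
  have h₁ : 0 < Module.finrank k (C ⟶ C) := Module.finrank_pos
  have h₂ : Module.finrank k (C ⟶ C) ≠ 1 := fun h' => h (hsimple h')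
  lia
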